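/- For $d\in\mathbb N$ and a unitary $U\in M_d(\mathbb C)$ with columns $u_1,\dots,u_d$, let $\mathcal P_U:M_d(\mathbb C)\to M_d(\mathbb C)$, $\mathcal P_U(\rho)=\sum_{i=1}^d\langle u_i|\rho|u_i\rangle\,|i\rangle\langle i|$, be the von Neumann measurement in the basis $(u_i)$, viewed as a quantum channel; in particular $\mathcal P_{\mathbb 1}$ is the measurement in the computational basis. For a linear map $\Phi$ on $M_d(\mathbb C)$ let $\|\Phi\|_\diamond=\max\{\|(\Phi\otimes\mathrm{id}_{M_d})(X)\|_1 : X\in M_d\otimes M_d,\ \|X\|_1=1\}$ be the diamond norm, where $\|A\|_1=\operatorname{Tr}\sqrt{A^\dagger A}$ is the trace norm. Two channels $\Phi,\Psi$ are called perfectly distinguishable if $\|\Phi-\Psi\|_\diamond=2$, i.e. if a single use, with entangled inputs allowed, suffices to discriminate them with probability $1$. Theorem. Let $U\in M_d(\mathbb C)$ be unitary and let $E\in M_d(\mathbb C)$ be a diagonal unitary matrix such that $\langle i|UE|i\rangle\ge 0$ (real and nonnegative) for every $i=1,\dots,d$. Then: 1. if $\mathcal P_U$ and $\mathcal P_{\mathbb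 1}$ are perfectly distinguishable, then $\operatorname{Tr}(UE)\le d-2$; 2. if $d\ge 3$ is odd and $\operatorname{Tr}(UE)\le 1$, then $\mathcal P_U$ and $\mathcal P_{\mathbb 1}$ are perfectly distinguishable. In particular, if $d=3$, then $\mathcal P_U$ and $\mathcal P_{\mathbb 1}$ are perfectly distinguishable if and only if $\operatorname{Tr}(UE)\le 1$. -/

import Mathlib

open scoped Matrix MatrixOrder ComplexOrder Kronecker

namespace MeasurementDiscrimination

noncomputable section

/-- The trace norm `‖A‖₁ = tr |A|`, where `|A| = √(A† A)`. -/
def traceNorm {n : Type*} [Fintype n] [DecidableEq n] (A : Matrix n n ℂ) : ℝ := (CFC.abs A).trace.re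

/-- The map `Φ ⊗ 1` on `M_n ⊗ M_k`, acting as `Φ` on the first tensor factor and as the identity
on the second one: each block `(X (a, s) (b, t))_{a b}` is replaced by its image under `Φ`. -/
def tensorId {m n : Type*} (Φ : Matrix n n ℂ →ₗ[ℂ] Matrix m m ℂ) (k : Type*) :
    Matrix (n × k) (n × k) ℂ →ₗ[ℂ] Matrix (m × k) (m × k) ℂ where
  toFun X := Matrix.of fun p q => Φ (Matrix.of fun a b => X (a, p.2) (b, q.2)) p.1 q.1
  map_add' X Y := by
    ext p q
    exact congrFun (congrFun (Φ.map_add (Matrix.of fun a b => X (a, p.2) (b, q.2))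
      (Matrix.of fun a b => Y (a, p.2) (b, q.2))) p.1) q.1
  map_smul' c X := by
    ext p q
    exact congrFun (congrFun (Φ.map_smul c (Matrix.of fun a b => X (a, p.2) (b, q.2))) p.1) q.1

/-- `Φ ⊗ 1` acts on product matrices as expected (and these span, so this determines it). -/
theorem tensorId_kronecker {m n k : Type*} (Φ : Matrix n n ℂ →ₗ[ℂ] Matrix m m ℂ)
    (A : Matrix n n ℂ) (B : Matrix k k ℂ) : tensorId Φ k (A ⊗ₖ B) = Φ A ⊗ₖ B := by
  ext p q
  have h : (Matrix.of fun a b => (A ⊗ₖ B) (a, p.2) (b, q.2)) = B p.2 q.2 • A := by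
    ext a b
    simp [Matrix.kroneckerMap_apply, mul_comm]
  change Φ (Matrix.of fun a b => (A ⊗ₖ B) (a, p.2) (b, q.2)) p.1 q.1 = _
  rw [h, map_smul]
  simp [Matrix.kroneckerMap_apply, mul_comm]

/-- The diamond norm (completely bounded trace norm)
`‖Φ‖_⋄ = max {‖(Φ ⊗ 1)(X)‖₁ : ‖X‖₁ = 1}`, where `1` is the identity map on an ancilla of the same
dimension as the input of `Φ`. -/
def diamondNorm {m n : Type*} [Fintype m] [DecidableEq m] [Fintype n] [DecidableEq n]
    (Φ : Matrix n n ℂ →ₗ[ℂ] Matrix m m ℂ) : ℝ :=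
  sSup {r : ℝ | ∃ X : Matrix (n × n) (n × n) ℂ,
    traceNorm X = 1 ∧ r = traceNorm (tensorId Φ n X)}

/-- The von Neumann measurement `𝒫_U`, as the measure-and-prepare channel
`ρ ↦ ∑ i, ⟨u_i| ρ |u_i⟩ |i⟩⟨i|`, where `u_i` is the `i`-th column of `U`. -/
def vonNeumann {n : Type*} [Fintype n] [DecidableEq n] (U : Matrix n n ℂ) :
    Matrix n n ℂ →ₗ[ℂ] Matrix n n ℂ where
  toFun ρ := Matrix.diagonal fun i => star (U.col i) ⬝ᵥ (ρ *ᵥ U.col i)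
  map_add' ρ σ := by
    rw [Matrix.diagonal_add]
    simp [Matrix.add_mulVec, dotProduct_add]
  map_smul' c ρ := by
    rw [← Matrix.diagonal_smul]
    congr 1
    ext i
    simp [Matrix.smul_mulVec, dotProduct_smul]

/-- Two channels are perfectly distinguishable (in one use, with entangled inputs allowed) when
their diamond-norm distance is `2`, the value for which the optimal success probability
`1/2 + ‖Φ - Ψ‖_⋄ / 4` is `1`. -/
def PerfectlyDistinguishable {m n : Type*} [Fintype m] [DecidableEq m]
    [Fintype n] [DecidableEq n] (Φ Ψ : Matrix n n ℂ →ₗ[ℂ] Matrix m m ℂ) : Prop :=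
  diamondNorm (Φ - Ψ) = 2

end

end MeasurementDiscrimination

open scoped Matrix.Norms.L2Operator

namespace MeasurementDiscrimination

/-! ### Duality between the trace norm and the operator norm -/

section TraceNorm

variable {n : Type*} [Fintype n] [DecidableEq n]

/-! Column phases do not affect a measurement, so `U` may be replaced by V = UE. Put W = V ⊗ 1. By
trace-norm duality the diamond norm is at most any bound on ‖W D Wᴴ − D‖ over block-diagonal
contractions D.

Necessity: compactness gives a contraction D for which this norm is at least 2. Equality in the
triangle inequality at a norming vector yields unit vectors a, b with ⟨a, Wa⟩ + ⟨b, Wb⟩ = 0. In an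
eigenbasis of V this reads ∑ pᵢ μᵢ = 0 with pᵢ ≥ 0 and ∑ pᵢ = 2. Unimodularity forces pᵢ ≤ 1, so ∑
(1 − Re μᵢ) ≥ ∑ pᵢ (1 − Re μᵢ) = 2.

Sufficiency: if a density matrix ρ satisfies diag(ρV) = 0, its purification gives orthogonal
outputs. Otherwise Hahn–Banach gives a diagonal D such that VD has positive definite real part. With
F the phases of D, all eigenvalues of the unitary VF lie in the open right half plane. An odd
number, at least 3, of such unit vectors has a sum of modulus > 1, whereas |Tr VF| ≤ ∑ |Vᵢᵢ| = Tr V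
≤ 1. For d = 3 both thresholds equal 1. -/

theorem norm_le_one_of_unitary {Q : Matrix n n ℂ} (hQ : Q ∈ Matrix.unitaryGroup n ℂ) :
    ‖Q‖ ≤ 1 := by
  cases subsingleton_or_nontrivial (Matrix n n ℂ) with
  | inl h => simp [Subsingleton.elim Q 0]
  | inr h => exact (CStarRing.norm_of_mem_unitary hQ).le

theorem traceNorm_of_posSemidef {A : Matrix n n ℂ} (hA : A.PosSemidef) :
    traceNorm A = A.trace.re := by
  rw [traceNorm, CFC.abs_of_nonneg A hA.nonneg]

/-- Orthogonality gives (P − R)² = (P + R)², hence |P − R| = P + R. -/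
theorem traceNorm_sub_of_mul_eq_zero {P R : Matrix n n ℂ} (hP : P.PosSemidef)
    (hR : R.PosSemidef) (h : P * R = 0) : traceNorm (P - R) = P.trace.re + R.trace.re := by
  have h' : R * P = 0 := by
    have := congrArg Matrix.conjTranspose h
    simpa [Matrix.conjTranspose_mul, hP.isHermitian.eq, hR.isHermitian.eq] using this
  have : CFC.abs (P - R) = P + R := by
    apply CFC.sqrt_unique
    · rw [Matrix.star_eq_conjTranspose, Matrix.conjTranspose_sub, hP.isHermitian.eq,
        hR.isHermitian.eq]
      simp only [add_mul, mul_add, sub_mul, mul_sub, h, h']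
      abel
    · exact (hP.add hR).nonneg
  rw [traceNorm, this, Matrix.trace_add, Complex.add_re]

/-- Singular value data of `A`: an orthonormal eigenbasis of `|A|`. -/
theorem exists_unitary_abs (A : Matrix n n ℂ) : ∃ (Q : Matrix n n ℂ) (s : n → ℝ),
    Q ∈ Matrix.unitaryGroup n ℂ ∧ (∀ i, 0 ≤ s i) ∧
    (A * Q)ᴴ * (A * Q) = Matrix.diagonal (fun i => (s i : ℂ) * s i) ∧
    traceNorm A = ∑ i, s i := by
  have hpos : (CFC.abs A).PosSemidef := Matrix.nonneg_iff_posSemidef.mp (CFC.abs_nonneg A)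
  have hh := hpos.isHermitian
  have hspec : CFC.abs A = (hh.eigenvectorUnitary : Matrix n n ℂ) *
      Matrix.diagonal (fun i => (hh.eigenvalues i : ℂ)) *
      (hh.eigenvectorUnitary : Matrix n n ℂ)ᴴ := by
    conv_lhs => rw [hh.spectral_theorem]
    rfl
  have hQ := hh.eigenvectorUnitary.2
  have hs := hpos.eigenvalues_nonneg
  generalize (hh.eigenvectorUnitary : Matrix n n ℂ) = Q at hspec hQ
  change ∀ i, 0 ≤ hh.eigenvalues i at hs
  generalize hh.eigenvalues = s at hspec hs
  have hQ1 : Qᴴ * Q = 1 := Matrix.mem_unitaryGroup_iff'.mp hQ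
  refine ⟨Q, s, hQ, hs, ?_, ?_⟩
  · have h2 := CFC.abs_mul_abs A
    rw [Matrix.star_eq_conjTranspose] at h2
    rw [Matrix.conjTranspose_mul]
    calc Qᴴ * Aᴴ * (A * Q) = Qᴴ * (Aᴴ * A) * Q := by simp only [Matrix.mul_assoc]
      _ = (Qᴴ * Q) * Matrix.diagonal (fun i => (s i : ℂ)) * (Qᴴ * Q) *
          Matrix.diagonal (fun i => (s i : ℂ)) * (Qᴴ * Q) := by
        rw [← h2, hspec]; simp only [Matrix.mul_assoc]
      _ = _ := by simp [hQ1, Matrix.diagonal_mul_diagonal]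
  · rw [traceNorm, hspec, Matrix.trace_mul_comm, ← Matrix.mul_assoc, hQ1, one_mul,
      Matrix.trace_diagonal]
    simp

/-- The trace is computed in an eigenbasis of |A|: A maps the i-th basis vector to a vector of norm
`s i`, and Cauchy–Schwarz bounds each term. -/
theorem re_trace_mul_le (B A : Matrix n n ℂ) : (B * A).trace.re ≤ ‖B‖ * traceNorm A := by
  obtain ⟨Q, s, hQ, hs, hAQ, htr⟩ := exists_unitary_abs A
  have hQ1 : Q * Qᴴ = 1 := Matrix.mem_unitaryGroup_iff.mp hQ
  have h1 : (B * A).trace = (Qᴴ * (B * (A * Q))).trace := by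
    rw [Matrix.trace_mul_comm Qᴴ]
    simp only [Matrix.mul_assoc, hQ1, mul_one]
  rw [h1, htr, Finset.mul_sum, Matrix.trace, Complex.re_sum]
  refine Finset.sum_le_sum fun i _ => ?_
  set y : EuclideanSpace ℂ n := WithLp.toLp 2 ((A * Q).col i)
  set z : EuclideanSpace ℂ n := WithLp.toLp 2 (B *ᵥ (A * Q).col i)
  set q : EuclideanSpace ℂ n := WithLp.toLp 2 (Q.col i)
  have hz : ‖z‖ ≤ ‖B‖ * ‖y‖ := Matrix.l2_opNorm_mulVec B y
  have hcol : ∀ M : Matrix n n ℂ, ‖(WithLp.toLp 2 (M.col i) : EuclideanSpace ℂ n)‖ ^ 2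
      = ((Mᴴ * M) i i).re := by
    intro M
    rw [EuclideanSpace.norm_sq_eq, Matrix.mul_apply, Complex.re_sum]
    refine Finset.sum_congr rfl fun j _ => ?_
    simp [Matrix.col, Complex.sq_norm, Complex.normSq_apply]
  have hy : ‖y‖ = s i := by
    have := hcol (A * Q)
    rw [hAQ] at this
    simp only [Matrix.diagonal_apply_eq] at this
    rw [← Complex.ofReal_mul, Complex.ofReal_re, ← sq] at this
    exact (sq_eq_sq₀ (norm_nonneg _) (hs i)).mp this
  have hq : ‖q‖ = 1 := by
    have := hcol Q
    rw [← Matrix.star_eq_conjTranspose, Matrix.mem_unitaryGroup_iff'.mp hQ] at this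
    exact (pow_eq_one_iff_of_nonneg (norm_nonneg q) two_ne_zero).mp (by rw [this]; simp)
  have hin : (Qᴴ * (B * (A * Q))).diag i = inner ℂ q z := by
    rw [Matrix.diag_apply, Matrix.mul_apply, PiLp.inner_apply]
    refine Finset.sum_congr rfl fun j _ => ?_
    simp [q, z, Matrix.col, mul_comm, Matrix.mul_apply, Matrix.mulVec, dotProduct]
  rw [hin]
  calc (inner ℂ q z).re ≤ ‖inner ℂ q z‖ := Complex.re_le_norm _
    _ ≤ ‖q‖ * ‖z‖ := norm_inner_le_norm _ _
    _ ≤ ‖B‖ * s i := by rw [hq, one_mul, ← hy]; exact hz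

theorem exists_trace_mul_eq_traceNorm (A : Matrix n n ℂ) :
    ∃ B : Matrix n n ℂ, ‖B‖ ≤ 1 ∧ (B * A).trace.re = traceNorm A := by
  obtain ⟨Q, s, hQ, hs, hAQ, htr⟩ := exists_unitary_abs A
  have hQ1 : Q * Qᴴ = 1 := Matrix.mem_unitaryGroup_iff.mp hQ
  -- With 0⁻¹ = 0 this makes the witness |A|⁺Aᴴ, with |A|⁺ the pseudoinverse; its product with A is
  -- |A|.
  set S : Matrix n n ℂ := Matrix.diagonal fun i => ((s i : ℂ))⁻¹ with hS
  have hSH : Sᴴ = S := by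
    rw [hS, Matrix.diagonal_conjTranspose]
    congr 1
    ext i
    simp
  refine ⟨Q * (S * (A * Q)ᴴ), ?_, ?_⟩
  · have hC : ‖S * (A * Q)ᴴ‖ ≤ 1 := by
      have h1 : (S * (A * Q)ᴴ) * (S * (A * Q)ᴴ)ᴴ
          = Matrix.diagonal (fun i => (s i : ℂ)⁻¹ * ((s i : ℂ) * s i) * (s i : ℂ)⁻¹) := by
        rw [Matrix.conjTranspose_mul S, Matrix.conjTranspose_conjTranspose, hSH]
        calc S * (A * Q)ᴴ * (A * Q * S) = S * ((A * Q)ᴴ * (A * Q)) * S := by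
              simp only [Matrix.mul_assoc]
          _ = _ := by rw [hAQ, hS, Matrix.diagonal_mul_diagonal, Matrix.diagonal_mul_diagonal]
      have h2 : ‖(S * (A * Q)ᴴ) * (S * (A * Q)ᴴ)ᴴ‖ ≤ 1 := by
        rw [h1, Matrix.l2_opNorm_diagonal, pi_norm_le_iff_of_nonneg zero_le_one]
        intro i
        by_cases h : (s i : ℂ) = 0
        · simp [h]
        · rw [show (s i : ℂ)⁻¹ * ((s i : ℂ) * s i) * (s i : ℂ)⁻¹ = 1 by field_simp]
          simp
      have h3 := CStarRing.norm_self_mul_star (x := S * (A * Q)ᴴ)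
      rw [Matrix.star_eq_conjTranspose] at h3
      rw [h3] at h2
      nlinarith [norm_nonneg (S * (A * Q)ᴴ)]
    calc _ ≤ ‖Q‖ * ‖S * (A * Q)ᴴ‖ := norm_mul_le _ _
      _ ≤ 1 * 1 := mul_le_mul (norm_le_one_of_unitary hQ) hC (norm_nonneg _) zero_le_one
      _ = 1 := one_mul 1
  · rw [Matrix.mul_assoc, Matrix.trace_mul_comm, htr]
    rw [show S * (A * Q)ᴴ * A * Q = S * ((A * Q)ᴴ * (A * Q)) by simp only [Matrix.mul_assoc],
      hAQ, hS, Matrix.diagonal_mul_diagonal, Matrix.trace_diagonal, Complex.re_sum]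
    refine Finset.sum_congr rfl fun i _ => ?_
    by_cases h : (s i : ℂ) = 0
    · have h0 : s i = 0 := by exact_mod_cast h
      simp [h0]
    · rw [show (s i : ℂ)⁻¹ * ((s i : ℂ) * s i) = s i by field_simp]
      simp

theorem traceNorm_nonneg (A : Matrix n n ℂ) : 0 ≤ traceNorm A := by
  obtain ⟨Q, s, -, hs, -, htr⟩ := exists_unitary_abs A
  exact htr ▸ Finset.sum_nonneg fun i _ => hs i

end TraceNorm

/-! ### The diamond norm through pinching -/

section Channels

variable {n : Type*} [Fintype n] [DecidableEq n]

/-- The pinching of a matrix on `ℂⁿ ⊗ ℂᵏ` to its diagonal blocks with respect to the first factor. -/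
def pinch {n k : Type*} [DecidableEq n] (B : Matrix (n × k) (n × k) ℂ) :
    Matrix (n × k) (n × k) ℂ :=
  Matrix.of fun p q => if p.1 = q.1 then B p q else 0

theorem trace_mul_pinch (B Y : Matrix (n × n) (n × n) ℂ) :
    (B * pinch Y).trace = (pinch B * Y).trace := by
  simp only [Matrix.trace, Matrix.diag_apply, Matrix.mul_apply, pinch, Matrix.of_apply]
  refine Finset.sum_congr rfl fun p _ => Finset.sum_congr rfl fun q _ => ?_
  by_cases h : p.1 = q.1
  · simp [h]
  · simp [h, Ne.symm h]

theorem tensorId_vonNeumann (U : Matrix n n ℂ) (X : Matrix (n × n) (n × n) ℂ) :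
    tensorId (vonNeumann U) n X
      = pinch ((U ⊗ₖ (1 : Matrix n n ℂ))ᴴ * X * (U ⊗ₖ (1 : Matrix n n ℂ))) := by
  ext ⟨i, s⟩ ⟨j, t⟩
  simp only [tensorId, vonNeumann, pinch, LinearMap.coe_mk, AddHom.coe_mk, Matrix.of_apply]
  by_cases h : i = j
  · subst h
    simp only [Matrix.diagonal_apply_eq, if_true]
    simp only [Matrix.mul_apply, Matrix.conjTranspose_apply, Matrix.kroneckerMap_apply,
      Fintype.sum_prod_type, Matrix.one_apply, dotProduct, Matrix.mulVec, Pi.star_apply,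
      Matrix.col_apply, Matrix.of_apply, mul_ite, mul_one, mul_zero, Finset.sum_ite_eq',
      Finset.mem_univ, if_true, apply_ite star, star_zero, ite_mul, zero_mul]
    simp only [Finset.mul_sum, Finset.sum_mul]
    rw [Finset.sum_comm]
    simp [mul_assoc]
  · simp [h]

/-- Passage to the Heisenberg picture: the difference of channels is moved onto the observable B,
using that pinching is self-adjoint for the trace pairing. -/
theorem trace_mul_tensorId_sub (U : Matrix n n ℂ) (B X : Matrix (n × n) (n × n) ℂ) :
    (B * tensorId (vonNeumann U - vonNeumann 1) n X).trace
      = (((U ⊗ₖ (1 : Matrix n n ℂ)) * pinch B * (U ⊗ₖ (1 : Matrix n n ℂ))ᴴ - pinch B) * X).trace := by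
  have h : tensorId (vonNeumann U - vonNeumann 1) n X
      = tensorId (vonNeumann U) n X - tensorId (vonNeumann 1) n X := by
    ext p q
    simp [tensorId]
  rw [h, mul_sub, Matrix.trace_sub, tensorId_vonNeumann, tensorId_vonNeumann, trace_mul_pinch,
    trace_mul_pinch, sub_mul, Matrix.trace_sub]
  congr 1
  · rw [← Matrix.mul_assoc, Matrix.trace_mul_comm]
    simp only [Matrix.mul_assoc]
  · simp

/-- The i-th block of the pinched image of x is the i-th block of B applied to the i-th block of x
alone, so squared norms add over i. -/
theorem norm_pinch_le (B : Matrix (n × n) (n × n) ℂ) : ‖pinch B‖ ≤ ‖B‖ := by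
  rw [Matrix.l2_opNorm_def]
  refine ContinuousLinearMap.opNorm_le_bound _ (norm_nonneg _) fun x => ?_
  have key : ∀ i : n, ∑ s, ‖(pinch B *ᵥ x.ofLp) (i, s)‖ ^ 2 ≤ ‖B‖ ^ 2 * ∑ s, ‖x (i, s)‖ ^ 2 := by
    intro i
    set xi : EuclideanSpace ℂ (n × n) :=
      WithLp.toLp 2 fun p => if p.1 = i then x p else 0 with hxi
    have h1 : ‖(WithLp.toLp 2 (B *ᵥ xi.ofLp) : EuclideanSpace ℂ (n × n))‖ ≤ ‖B‖ * ‖xi‖ :=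
      Matrix.l2_opNorm_mulVec B xi
    have h2 : ‖xi‖ ^ 2 = ∑ s, ‖x (i, s)‖ ^ 2 := by
      rw [EuclideanSpace.norm_sq_eq, Fintype.sum_prod_type, Finset.sum_eq_single i]
      · simp [hxi]
      · intro j _ hj
        simp [hxi, hj]
      · simp
    have h3 : ∀ s, (pinch B *ᵥ x.ofLp) (i, s) = (B *ᵥ xi.ofLp) (i, s) := by
      intro s
      simp only [Matrix.mulVec, dotProduct, hxi, pinch, Matrix.of_apply]
      refine Finset.sum_congr rfl fun p _ => ?_
      by_cases h : p.1 = i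
      · simp [h]
      · simp [h, Ne.symm h]
    have h4 : ∑ s, ‖(pinch B *ᵥ x.ofLp) (i, s)‖ ^ 2
        ≤ ‖(WithLp.toLp 2 (B *ᵥ xi.ofLp) : EuclideanSpace ℂ (n × n))‖ ^ 2 := by
      rw [EuclideanSpace.norm_sq_eq, Fintype.sum_prod_type]
      simp only [h3]
      exact Finset.single_le_sum (f := fun j => ∑ s, ‖(B *ᵥ xi.ofLp) (j, s)‖ ^ 2)
        (fun j _ => Finset.sum_nonneg fun s _ => sq_nonneg _) (Finset.mem_univ i)
    rw [← h2, ← mul_pow]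
    exact h4.trans (pow_le_pow_left₀ (norm_nonneg _) h1 2)
  refine le_of_sq_le_sq ?_ (by positivity)
  rw [mul_pow, EuclideanSpace.norm_sq_eq, EuclideanSpace.norm_sq_eq, Fintype.sum_prod_type,
    Fintype.sum_prod_type, Finset.mul_sum]
  exact Finset.sum_le_sum fun i _ => key i

theorem kronecker_one_mem_unitary {U : Matrix n n ℂ} (hU : U ∈ Matrix.unitaryGroup n ℂ) :
    U ⊗ₖ (1 : Matrix n n ℂ) ∈ Matrix.unitaryGroup (n × n) ℂ :=
  Matrix.kronecker_mem_unitary hU (one_mem _)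

theorem norm_conj_sub_le_two {m : Type*} [Fintype m] [DecidableEq m] {W D : Matrix m m ℂ}
    (hW : W ∈ Matrix.unitaryGroup m ℂ) (hD : ‖D‖ ≤ 1) : ‖W * D * Wᴴ - D‖ ≤ 2 := by
  have hW1 := norm_le_one_of_unitary hW
  have hW2 : ‖Wᴴ‖ ≤ 1 := by rwa [Matrix.l2_opNorm_conjTranspose]
  have h1 : ‖W * D * Wᴴ‖ ≤ 1 := by
    calc _ ≤ ‖W‖ * ‖D‖ * ‖Wᴴ‖ := (norm_mul_le _ _).trans
          (mul_le_mul_of_nonneg_right (norm_mul_le _ _) (norm_nonneg _))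
      _ ≤ 1 * 1 * 1 := by gcongr
      _ = 1 := by norm_num
  linarith [norm_sub_le (W * D * Wᴴ) D]

theorem traceNorm_tensorId_sub_le {U : Matrix n n ℂ} {c : ℝ}
    (hc : ∀ B : Matrix (n × n) (n × n) ℂ, ‖B‖ ≤ 1 →
      ‖(U ⊗ₖ (1 : Matrix n n ℂ)) * pinch B * (U ⊗ₖ (1 : Matrix n n ℂ))ᴴ - pinch B‖ ≤ c)
    (X : Matrix (n × n) (n × n) ℂ) :
    traceNorm (tensorId (vonNeumann U - vonNeumann 1) n X) ≤ c * traceNorm X := by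
  obtain ⟨B, hB, htr⟩ :=
    exists_trace_mul_eq_traceNorm (tensorId (vonNeumann U - vonNeumann 1) n X)
  rw [← htr, trace_mul_tensorId_sub]
  exact (re_trace_mul_le _ _).trans
    (mul_le_mul_of_nonneg_right (hc B hB) (traceNorm_nonneg X))

theorem diamondNorm_sub_le {U : Matrix n n ℂ} {c : ℝ}
    (hc : ∀ B : Matrix (n × n) (n × n) ℂ, ‖B‖ ≤ 1 →
      ‖(U ⊗ₖ (1 : Matrix n n ℂ)) * pinch B * (U ⊗ₖ (1 : Matrix n n ℂ))ᴴ - pinch B‖ ≤ c) :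
    diamondNorm (vonNeumann U - vonNeumann 1) ≤ c := by
  -- For an empty index type no X has trace norm 1, and `sSup ∅ = 0`.
  have hc0 : 0 ≤ c := (norm_nonneg _).trans (hc 0 (by simp))
  refine Real.sSup_le ?_ hc0
  rintro r ⟨X, hX, rfl⟩
  simpa [hX] using traceNorm_tensorId_sub_le hc X

theorem norm_conj_pinch_sub_le_two {U : Matrix n n ℂ} (hU : U ∈ Matrix.unitaryGroup n ℂ)
    {B : Matrix (n × n) (n × n) ℂ} (hB : ‖B‖ ≤ 1) :
    ‖(U ⊗ₖ (1 : Matrix n n ℂ)) * pinch B * (U ⊗ₖ (1 : Matrix n n ℂ))ᴴ - pinch B‖ ≤ 2 :=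
  norm_conj_sub_le_two (kronecker_one_mem_unitary hU) ((norm_pinch_le B).trans hB)

theorem perfectlyDistinguishable_of_traceNorm_eq_two {U : Matrix n n ℂ}
    (hU : U ∈ Matrix.unitaryGroup n ℂ) {X : Matrix (n × n) (n × n) ℂ} (hX : traceNorm X = 1)
    (h : traceNorm (tensorId (vonNeumann U - vonNeumann 1) n X) = 2) :
    PerfectlyDistinguishable (vonNeumann U) (vonNeumann 1) := by
  have hb : ∀ B : Matrix (n × n) (n × n) ℂ, ‖B‖ ≤ 1 → _ := fun B hB =>
    norm_conj_pinch_sub_le_two hU hB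
  refine le_antisymm (diamondNorm_sub_le hb) (le_csSup ⟨2, ?_⟩ ⟨X, hX, h.symm⟩)
  rintro r ⟨Y, hY, rfl⟩
  simpa [hY] using traceNorm_tensorId_sub_le hb Y

theorem continuous_pinch {n : Type*} [DecidableEq n] :
    Continuous (pinch : Matrix (n × n) (n × n) ℂ → Matrix (n × n) (n × n) ℂ) := by
  refine continuous_matrix fun p q => ?_
  by_cases h : p.1 = q.1
  · simpa [pinch, h] using continuous_id.matrix_elem p q
  · simpa [pinch, h] using continuous_const

/-- By compactness, if the diamond norm is `2`, then some contraction attains the bound. -/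
theorem PerfectlyDistinguishable.exists_two_le_norm {U : Matrix n n ℂ}
    (h : PerfectlyDistinguishable (vonNeumann U) (vonNeumann 1)) :
    ∃ D : Matrix (n × n) (n × n) ℂ, ‖D‖ ≤ 1 ∧
      2 ≤ ‖(U ⊗ₖ (1 : Matrix n n ℂ)) * D * (U ⊗ₖ (1 : Matrix n n ℂ))ᴴ - D‖ := by
  have : ProperSpace (Matrix (n × n) (n × n) ℂ) := FiniteDimensional.proper ℂ _
  have hcont : Continuous fun B : Matrix (n × n) (n × n) ℂ =>
      ‖(U ⊗ₖ (1 : Matrix n n ℂ)) * pinch B * (U ⊗ₖ (1 : Matrix n n ℂ))ᴴ - pinch B‖ :=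
    continuous_norm.comp
      (((continuous_const.mul continuous_pinch).mul continuous_const).sub continuous_pinch)
  obtain ⟨B, hB, hmax⟩ := (isCompact_closedBall (0 : Matrix (n × n) (n × n) ℂ) 1).exists_isMaxOn
    ⟨0, Metric.mem_closedBall_self zero_le_one⟩ hcont.continuousOn
  refine ⟨pinch B, (norm_pinch_le B).trans (mem_closedBall_zero_iff.mp hB), ?_⟩
  rw [← show diamondNorm (vonNeumann U - vonNeumann 1) = 2 from h]
  exact diamondNorm_sub_le fun C hC => hmax (mem_closedBall_zero_iff.mpr hC)

end Channels

/-! ### Necessity: the trace bound -/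

section Necessary

/-- Expanding gives ‖D†Dc − c‖² = ‖D†Dc‖² − 2‖Dc‖² + ‖c‖² ≤ 0. -/
theorem adjoint_apply_self_of_norm_eq {E : Type*} [NormedAddCommGroup E] [InnerProductSpace ℂ E]
    [CompleteSpace E] {D : E →L[ℂ] E} (hD : ‖D‖ ≤ 1) {c : E} (hc : ‖D c‖ = ‖c‖) :
    ContinuousLinearMap.adjoint D (D c) = c := by
  have h1 : ‖ContinuousLinearMap.adjoint D (D c)‖ ≤ ‖c‖ := by
    refine (ContinuousLinearMap.le_opNorm _ _).trans ?_
    rw [LinearIsometryEquiv.norm_map, hc]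
    exact mul_le_of_le_one_left (norm_nonneg _) hD
  have h2 := norm_sub_sq (𝕜 := ℂ) (ContinuousLinearMap.adjoint D (D c)) c
  rw [ContinuousLinearMap.adjoint_inner_left, inner_self_eq_norm_sq, hc] at h2
  have h3 := pow_le_pow_left₀ (norm_nonneg _) h1 2
  rw [← sub_eq_zero, ← norm_eq_zero, ← sq_eq_zero_iff]
  exact le_antisymm (by linarith) (sq_nonneg _)

theorem exists_norm_apply_eq_opNorm {E : Type*} [NormedAddCommGroup E] [InnerProductSpace ℂ E]
    [FiniteDimensional ℂ E] (T : E →L[ℂ] E) : ∃ x : E, ‖x‖ ≤ 1 ∧ ‖T x‖ = ‖T‖ := by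
  have : ProperSpace E := FiniteDimensional.proper ℂ E
  have hne : ((fun x => ‖T x‖) '' Metric.closedBall (0 : E) 1).Nonempty :=
    ⟨_, 0, Metric.mem_closedBall_self zero_le_one, rfl⟩
  obtain ⟨x, hx, h⟩ := ((isCompact_closedBall (0 : E) 1).image
    (continuous_norm.comp T.continuous)).sSup_mem hne
  exact ⟨x, mem_closedBall_zero_iff.mp hx, h.trans T.sSup_unitClosedBall_eq_norm⟩

theorem exists_inner_add_inner_eq_zero {E : Type*} [NormedAddCommGroup E] [InnerProductSpace ℂ E]
    [FiniteDimensional ℂ E] [CompleteSpace E] {D W : E →L[ℂ] E} (hD : ‖D‖ ≤ 1)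
    (hW : W ∈ unitary (E →L[ℂ] E)) (h : 2 ≤ ‖W * D * star W - D‖) :
    ∃ a b : E, ‖a‖ = 1 ∧ ‖b‖ = 1 ∧ inner ℂ a (W a) + inner ℂ b (W b) = 0 := by
  obtain ⟨b, hb, hb2⟩ := exists_norm_apply_eq_opNorm (W * D * star W - D)
  rw [← hb2] at h
  have hWn : ∀ x, ‖W x‖ = ‖x‖ := fun x => ContinuousLinearMap.norm_map_of_mem_unitary hW x
  have hWn' : ∀ x, ‖star W x‖ = ‖x‖ :=
    fun x => ContinuousLinearMap.norm_map_of_mem_unitary (Unitary.star_mem hW) x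
  have hDn : ∀ x, ‖D x‖ ≤ ‖x‖ := fun x =>
    (D.le_opNorm x).trans (mul_le_of_le_one_left (norm_nonneg _) hD)
  set c := star W b with hc
  set p := W (D c) with hp
  have hsub : (W * D * star W - D) b = p - D b := rfl
  rw [hsub] at h
  have hcn : ‖c‖ = ‖b‖ := hWn' b
  have hpn : ‖p‖ = ‖D c‖ := hWn _
  have hpb : ‖p‖ ≤ ‖b‖ := by rw [hpn, ← hcn]; exact hDn c
  have htri := norm_sub_le p (D b)
  have hDb := hDn b
  -- Since 2 ≤ ‖p − Db‖ ≤ ‖p‖ + ‖Db‖ and both terms are at most ‖b‖ ≤ 1, everything is an equality;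
  -- the parallelogram law then gives p = −Db.
  have hp1 : ‖p‖ = 1 := by linarith
  have hb1 : ‖b‖ = 1 := by linarith
  have hDb1 : ‖D b‖ = 1 := by linarith
  have hpar := parallelogram_law_with_norm ℂ p (D b)
  have hsum : p + D b = 0 := by
    rw [← norm_eq_zero, ← sq_eq_zero_iff]
    refine le_antisymm ?_ (sq_nonneg _)
    rw [hp1, hDb1] at hpar
    nlinarith
  have hDD : ContinuousLinearMap.adjoint D (D c) = c :=
    adjoint_apply_self_of_norm_eq hD (by rw [← hpn, hcn, hp1, hb1])
  have hstar : star W p = D c := by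
    have : (star W * W) (D c) = D c := by rw [(Unitary.mem_iff.mp hW).1]; rfl
    exact this
  have hadj : ∀ x, inner ℂ (W x) x = inner ℂ x (star W x) := fun x =>
    (ContinuousLinearMap.adjoint_inner_right W x x).symm
  refine ⟨p, b, hp1, hb1, ?_⟩
  -- ⟨p, W†p⟩ = −⟨Db, Dc⟩ = −⟨b, D†Dc⟩ = −⟨b, c⟩ with c = W†b.
  have key : inner ℂ (W p) p = - inner ℂ (W b) b := by
    rw [hadj, hadj, hstar, ← hc, eq_neg_of_add_eq_zero_left hsum, inner_neg_left,
      ← ContinuousLinearMap.adjoint_inner_right, hDD]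
  have := congrArg (starRingEnd ℂ) key
  rw [map_neg, inner_conj_symm, inner_conj_symm] at this
  rw [this, neg_add_cancel]

variable {n : Type*} [Fintype n] [DecidableEq n]

/-- The circle is infinite and the spectrum finite. Such a z is the base point of the Cayley
transform. -/
theorem exists_norm_eq_one_det_ne_zero (V : Matrix n n ℂ) :
    ∃ z : ℂ, ‖z‖ = 1 ∧ (z • (1 : Matrix n n ℂ) - V).det ≠ 0 := by
  by_contra! hcon
  have hsub : Metric.sphere (0 : ℂ) 1 ⊆ {z | z ∈ V.charpoly.roots} := by
    intro z hz
    rw [Set.mem_ofPred_eq, Polynomial.mem_roots V.charpoly_monic.ne_zero, Polynomial.IsRoot,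
      Matrix.eval_charpoly]
    have := hcon z (by simpa using hz)
    rwa [Matrix.smul_one_eq_diagonal] at this
  have hfin : (Metric.sphere (0 : ℂ) 1).Finite :=
    (V.charpoly.roots.toFinset.finite_toSet.subset fun z hz => by simpa using hsub hz)
  have hnt : (Metric.sphere (0 : ℂ) 1).Nontrivial :=
    ⟨1, by simp, -1, by simp, by norm_num⟩
  exact (isPreconnected_sphere (by simp) (0 : ℂ) 1).infinite_of_nontrivial hnt hfin

/-- Spectral theorem for unitary matrices, by the Cayley transform. -/
theorem exists_unitary_diagonalization {V : Matrix n n ℂ} (hV : V ∈ Matrix.unitaryGroup n ℂ) :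
    ∃ (Q : Matrix n n ℂ) (μ : n → ℂ), Q ∈ Matrix.unitaryGroup n ℂ ∧
      V = Q * Matrix.diagonal μ * Qᴴ ∧ ∀ i, ‖μ i‖ = 1 := by
  obtain ⟨z, hz, hdet⟩ := exists_norm_eq_one_det_ne_zero V
  have hVV : Vᴴ * V = 1 := Matrix.mem_unitaryGroup_iff'.mp hV
  have hzz : star z * z = 1 := by
    rw [Complex.star_def, Complex.conj_mul', hz]; norm_num
  set N := z • (1 : Matrix n n ℂ) - V with hN
  have hu : IsUnit N.det := isUnit_iff_ne_zero.mpr hdet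
  set K : Matrix n n ℂ := Complex.I • (star z • V - z • Vᴴ) with hK
  have hKh : K.IsHermitian := by
    rw [Matrix.IsHermitian, hK]
    simp only [Matrix.conjTranspose_smul, Matrix.conjTranspose_sub,
      Matrix.conjTranspose_conjTranspose, Complex.star_def, Complex.conj_I, Complex.conj_conj]
    rw [neg_smul, ← smul_neg, neg_sub]
  have hKN : K = Complex.I • (Nᴴ * (z • (1 : Matrix n n ℂ) + V)) := by
    rw [hK, hN]
    congr 1
    simp only [Matrix.conjTranspose_smul, Matrix.conjTranspose_sub, Matrix.conjTranspose_one,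
      sub_mul, mul_add, hVV, smul_mul_assoc, mul_smul_comm, one_mul, mul_one, smul_sub, smul_smul]
    rw [mul_comm z, hzz, one_smul]
    abel
  -- H is i(z + V)(z − V)⁻¹, written as a congruence of K so that it is visibly Hermitian.
  set H : Matrix n n ℂ := N⁻¹ᴴ * K * N⁻¹ with hH
  have hHh : H.IsHermitian := Matrix.isHermitian_conjTranspose_mul_mul _ hKh
  have hHN : H * N = Complex.I • (z • (1 : Matrix n n ℂ) + V) := by
    rw [hH, Matrix.mul_assoc, Matrix.nonsing_inv_mul N hu, mul_one, hKN, mul_smul_comm,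
      ← Matrix.mul_assoc, ← Matrix.conjTranspose_mul, Matrix.mul_nonsing_inv N hu,
      Matrix.conjTranspose_one, one_mul]
  have hHV : H * V + Complex.I • V = z • H - (Complex.I * z) • 1 := by
    rw [hN, mul_sub, mul_smul_comm, mul_one, smul_add, smul_smul] at hHN
    rw [sub_eq_iff_eq_add] at hHN
    rw [hHN]
    abel
  have hspec : H = (hHh.eigenvectorUnitary : Matrix n n ℂ) *
      Matrix.diagonal (fun i => (hHh.eigenvalues i : ℂ)) *
      (hHh.eigenvectorUnitary : Matrix n n ℂ)ᴴ := by
    conv_lhs => rw [hHh.spectral_theorem]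
    rfl
  have hQ := hHh.eigenvectorUnitary.2
  generalize (hHh.eigenvectorUnitary : Matrix n n ℂ) = Q at hspec hQ
  generalize hHh.eigenvalues = e at hspec
  have hQ1 : Qᴴ * Q = 1 := Matrix.mem_unitaryGroup_iff'.mp hQ
  have hQ2 : Q * Qᴴ = 1 := Matrix.mem_unitaryGroup_iff.mp hQ
  have hne : ∀ i, (e i : ℂ) + Complex.I ≠ 0 := by
    intro i h
    simpa using congrArg Complex.im h
  have hdiag : Qᴴ * V * Q
      = Matrix.diagonal fun i => z * ((e i : ℂ) - Complex.I) / ((e i : ℂ) + Complex.I) := by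
    have h1 : Matrix.diagonal (fun i => (e i : ℂ)) * (Qᴴ * V * Q) + Complex.I • (Qᴴ * V * Q)
        = z • Matrix.diagonal (fun i => (e i : ℂ)) - (Complex.I * z) • 1 := by
      have h2 := congrArg (fun M => Qᴴ * M * Q) hHV
      simp only [mul_add, add_mul, mul_sub, sub_mul, mul_smul_comm, smul_mul_assoc, mul_one,
        hQ1] at h2
      have h3 : Qᴴ * H * Q = Matrix.diagonal (fun i => (e i : ℂ)) := by
        rw [hspec]
        calc _ = (Qᴴ * Q) * Matrix.diagonal (fun i => (e i : ℂ)) * (Qᴴ * Q) := by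
              simp only [Matrix.mul_assoc]
          _ = _ := by rw [hQ1, one_mul, mul_one]
      have h4 : Qᴴ * (H * V) * Q = Matrix.diagonal (fun i => (e i : ℂ)) * (Qᴴ * V * Q) := by
        rw [← h3]
        calc _ = Qᴴ * H * 1 * V * Q := by simp only [Matrix.mul_assoc, mul_one]
          _ = _ := by rw [← hQ2]; simp only [Matrix.mul_assoc]
      rwa [h3, h4] at h2
    ext i j
    have h2 := congrFun (congrFun h1 i) j
    rw [Matrix.add_apply, Matrix.diagonal_mul, Matrix.smul_apply, Matrix.sub_apply,
      Matrix.smul_apply, Matrix.smul_apply, smul_eq_mul, smul_eq_mul, smul_eq_mul] at h2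
    by_cases hij : i = j
    · subst hij
      rw [Matrix.diagonal_apply_eq, eq_div_iff (hne i)]
      rw [Matrix.diagonal_apply_eq, Matrix.one_apply_eq] at h2
      linear_combination h2
    · rw [Matrix.diagonal_apply_ne _ hij]
      rw [Matrix.diagonal_apply_ne _ hij, Matrix.one_apply_ne hij, mul_zero, mul_zero, sub_zero,
        ← add_mul] at h2
      exact (mul_eq_zero.mp h2).resolve_left (hne i)
  refine ⟨Q, fun i => z * ((e i : ℂ) - Complex.I) / ((e i : ℂ) + Complex.I), hQ, ?_, fun i => ?_⟩
  swap
  · have h1 : ‖(e i : ℂ) - Complex.I‖ = ‖(e i : ℂ) + Complex.I‖ := by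
      rw [← Complex.norm_conj]
      simp
    rw [norm_div, norm_mul, hz, one_mul, h1, div_self (norm_ne_zero_iff.mpr (hne i))]
  rw [← hdiag]
  calc V = (Q * Qᴴ) * V * (Q * Qᴴ) := by rw [hQ2, one_mul, mul_one]
    _ = _ := by simp only [Matrix.mul_assoc]

/-- If `0` is a convex combination of points of the unit circle, their sum has real part at most
two less than their number. -/
theorem re_sum_le_card_sub_two {μ : n → ℂ} (hμ : ∀ i, ‖μ i‖ = 1) {p : n → ℝ} (hp : ∀ i, 0 ≤ p i)
    (hsum : ∑ i, p i = 2) (h : ∑ i, (p i : ℂ) * μ i = 0) :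
    (∑ i, μ i).re ≤ Fintype.card n - 2 := by
  -- Isolating one term: pᵢ = |∑_{j ≠ i} pⱼ μⱼ| ≤ 2 − pᵢ.
  have hp1 : ∀ i, p i ≤ 1 := by
    intro i
    rw [← Finset.add_sum_erase _ _ (Finset.mem_univ i)] at h hsum
    have h1 : ‖(p i : ℂ) * μ i‖ = p i := by
      rw [norm_mul, hμ, mul_one, Complex.norm_of_nonneg (hp i)]
    have h2 : ‖∑ j ∈ Finset.univ.erase i, (p j : ℂ) * μ j‖ ≤ ∑ j ∈ Finset.univ.erase i, p j := by
      refine norm_sum_le_of_le _ fun j _ => ?_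
      rw [norm_mul, hμ, mul_one, Complex.norm_of_nonneg (hp j)]
    rw [eq_neg_of_add_eq_zero_left h, norm_neg] at h1
    linarith
  have hre : ∀ i, (μ i).re ≤ 1 := fun i => (Complex.re_le_norm _).trans (hμ i).le
  have h1 : ∑ i, p i * (1 - (μ i).re) ≤ ∑ i, (1 - (μ i).re) :=
    Finset.sum_le_sum fun i _ => mul_le_of_le_one_left (sub_nonneg.mpr (hre i)) (hp1 i)
  have h2 : ∑ i, p i * (μ i).re = 0 := by
    have := congrArg Complex.re h
    simpa using this
  simp only [mul_sub, mul_one, Finset.sum_sub_distrib, h2, hsum] at h1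
  rw [Complex.re_sum]
  simp only [Finset.sum_const, Finset.card_univ, nsmul_eq_mul, mul_one] at h1
  linarith

theorem inner_kronecker_one_apply (Q : Matrix n n ℂ) (μ : n → ℂ) (a : EuclideanSpace ℂ (n × n)) :
    inner ℂ a (Matrix.toEuclideanCLM (𝕜 := ℂ)
      ((Q * Matrix.diagonal μ * Qᴴ) ⊗ₖ (1 : Matrix n n ℂ)) a)
      = ∑ i, ((∑ s, ‖((Q ⊗ₖ (1 : Matrix n n ℂ))ᴴ *ᵥ a.ofLp) (i, s)‖ ^ 2 : ℝ) : ℂ) * μ i := by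
  set y := (Q ⊗ₖ (1 : Matrix n n ℂ))ᴴ *ᵥ a.ofLp with hy
  have h1 : (Q * Matrix.diagonal μ * Qᴴ) ⊗ₖ (1 : Matrix n n ℂ) = (Q ⊗ₖ (1 : Matrix n n ℂ)) *
      (Matrix.diagonal fun p : n × n => μ p.1) * (Q ⊗ₖ (1 : Matrix n n ℂ))ᴴ := by
    have h2 : (Matrix.diagonal fun p : n × n => μ p.1)
        = Matrix.diagonal μ ⊗ₖ (1 : Matrix n n ℂ) := by
      rw [← Matrix.diagonal_one, Matrix.diagonal_kronecker_diagonal]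
      simp
    rw [h2, Matrix.conjTranspose_kronecker, ← Matrix.mul_kronecker_mul, ← Matrix.mul_kronecker_mul]
    simp
  have h3 : inner ℂ a (Matrix.toEuclideanCLM (𝕜 := ℂ)
      ((Q * Matrix.diagonal μ * Qᴴ) ⊗ₖ (1 : Matrix n n ℂ)) a)
      = star y ⬝ᵥ (Matrix.diagonal (fun p : n × n => μ p.1) *ᵥ y) := by
    rw [EuclideanSpace.inner_eq_star_dotProduct, Matrix.ofLp_toEuclideanCLM, h1, dotProduct_comm,
      ← Matrix.mulVec_mulVec, ← hy, ← Matrix.mulVec_mulVec, Matrix.dotProduct_mulVec, hy,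
      Matrix.star_mulVec, Matrix.conjTranspose_conjTranspose]
  rw [h3, dotProduct, Fintype.sum_prod_type]
  refine Finset.sum_congr rfl fun i _ => ?_
  rw [Complex.ofReal_sum, Finset.sum_mul]
  refine Finset.sum_congr rfl fun s _ => ?_
  rw [Matrix.mulVec_diagonal, Pi.star_apply, Complex.star_def, Complex.ofReal_pow,
    ← Complex.conj_mul']
  ring

theorem PerfectlyDistinguishable.re_trace_le {V : Matrix n n ℂ}
    (hV : V ∈ Matrix.unitaryGroup n ℂ)
    (h : PerfectlyDistinguishable (vonNeumann V) (vonNeumann 1)) :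
    V.trace.re ≤ Fintype.card n - 2 := by
  obtain ⟨D, hD, hnorm⟩ := h.exists_two_le_norm
  obtain ⟨Q, μ, hQ, hVQ, hμ⟩ := exists_unitary_diagonalization hV
  have hQ1 : Qᴴ * Q = 1 := Matrix.mem_unitaryGroup_iff'.mp hQ
  have hW := kronecker_one_mem_unitary hV
  set T := Matrix.toEuclideanCLM (n := n × n) (𝕜 := ℂ)
  obtain ⟨a, b, ha, hb, hab⟩ := exists_inner_add_inner_eq_zero (D := T D)
    (W := T (V ⊗ₖ (1 : Matrix n n ℂ))) hD (Unitary.map_mem T hW) (by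
      rw [← map_star, ← map_mul, ← map_mul, ← map_sub]
      exact hnorm)
  rw [hVQ, inner_kronecker_one_apply, inner_kronecker_one_apply, ← Finset.sum_add_distrib] at hab
  simp only [← add_mul, ← Complex.ofReal_add] at hab
  have htr : V.trace = ∑ i, μ i := by
    rw [hVQ, Matrix.trace_mul_comm, ← Matrix.mul_assoc, hQ1, one_mul, Matrix.trace_diagonal]
  have hnorm1 : ∀ x : EuclideanSpace ℂ (n × n), ‖x‖ = 1 →
      ∑ i, ∑ s, ‖((Q ⊗ₖ (1 : Matrix n n ℂ))ᴴ *ᵥ x.ofLp) (i, s)‖ ^ 2 = 1 := by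
    intro x hx
    have hQu : T (Q ⊗ₖ (1 : Matrix n n ℂ))ᴴ ∈ unitary _ :=
      Unitary.map_mem T (Unitary.star_mem (kronecker_one_mem_unitary hQ))
    have h1 := ContinuousLinearMap.norm_map_of_mem_unitary hQu x
    rw [hx, ← pow_eq_one_iff_of_nonneg (norm_nonneg _) two_ne_zero, EuclideanSpace.norm_sq_eq,
      Fintype.sum_prod_type] at h1
    exact h1
  rw [htr]
  refine re_sum_le_card_sub_two hμ (fun i => ?_) ?_ hab
  · positivity
  · rw [Finset.sum_add_distrib, hnorm1 a ha, hnorm1 b hb]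
    norm_num

end Necessary

/-! ### Sufficiency: orthogonal outputs from a density matrix -/

section Sufficient

variable {n : Type*} [Fintype n] [DecidableEq n]

theorem pinch_vecMulVec (y : n × n → ℂ) :
    pinch (Matrix.vecMulVec y (star y)) = ∑ i, Matrix.vecMulVec
      (fun p : n × n => if p.1 = i then y p else 0)
      (star fun p : n × n => if p.1 = i then y p else 0) := by
  ext p q
  rw [Matrix.sum_apply, Finset.sum_eq_single p.1]
  · by_cases h : p.1 = q.1
    · simp [pinch, Matrix.vecMulVec_apply, h]
    · simp [pinch, Matrix.vecMulVec_apply, h, Ne.symm h]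
  · intro i _ hi
    simp [Matrix.vecMulVec_apply, Ne.symm hi]
  · simp

theorem posSemidef_pinch_vecMulVec (y : n × n → ℂ) :
    (pinch (Matrix.vecMulVec y (star y))).PosSemidef := by
  rw [pinch_vecMulVec]
  exact Matrix.posSemidef_sum _ fun i _ => Matrix.posSemidef_vecMulVec_self_star _

theorem trace_vecMulVec_uncurry {n : Type*} [Fintype n] (Y : Matrix n n ℂ) :
    (Matrix.vecMulVec (fun p : n × n => Y p.1 p.2) (star fun p : n × n => Y p.1 p.2)).trace
      = (Y * Yᴴ).trace := by
  simp [Matrix.trace, Matrix.vecMulVec_apply, Fintype.sum_prod_type, Matrix.mul_apply]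

theorem trace_pinch (B : Matrix (n × n) (n × n) ℂ) : (pinch B).trace = B.trace := by
  simp [Matrix.trace, pinch]

/-- The i-th diagonal block of the product is yᵢyᵢ†zᵢzᵢ†, whose middle scalar is `(Z * Yᴴ) i i`. -/
theorem pinch_mul_pinch_eq_zero {Y Z : Matrix n n ℂ} (h : ∀ i, (Z * Yᴴ) i i = 0) :
    pinch (Matrix.vecMulVec (fun p : n × n => Y p.1 p.2) (star fun p : n × n => Y p.1 p.2))
      * pinch (Matrix.vecMulVec (fun p : n × n => Z p.1 p.2) (star fun p : n × n => Z p.1 p.2))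
      = 0 := by
  ext ⟨i, s⟩ ⟨j, t⟩
  have h1 := h i
  rw [Matrix.mul_apply] at h1
  rw [Matrix.mul_apply, Fintype.sum_prod_type, Finset.sum_eq_single i, Matrix.zero_apply]
  · by_cases hij : i = j
    · subst hij
      have h2 : ∀ r, pinch (Matrix.vecMulVec (fun p : n × n => Y p.1 p.2)
            (star fun p : n × n => Y p.1 p.2)) (i, s) (i, r)
          * pinch (Matrix.vecMulVec (fun p : n × n => Z p.1 p.2)
            (star fun p : n × n => Z p.1 p.2)) (i, r) (i, t)
          = (Y i s * star (Z i t)) * (Z i r * Yᴴ r i) := by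
        intro r
        simp only [pinch, Matrix.of_apply, Matrix.vecMulVec_apply, Pi.star_apply, if_true,
          Matrix.conjTranspose_apply]
        ring
      simp only [h2]
      rw [← Finset.mul_sum, h1, mul_zero]
    · simp [pinch, hij]
  · intro k _ hk
    simp [pinch, Ne.symm hk]
  · simp

theorem conjTranspose_mul_vecMulVec_mul (V C : Matrix n n ℂ) :
    (V ⊗ₖ (1 : Matrix n n ℂ))ᴴ *
      Matrix.vecMulVec (fun p : n × n => C p.1 p.2) (star fun p : n × n => C p.1 p.2) *
      (V ⊗ₖ (1 : Matrix n n ℂ))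
    = Matrix.vecMulVec (fun p : n × n => (Vᴴ * C) p.1 p.2)
      (star fun p : n × n => (Vᴴ * C) p.1 p.2) := by
  have h : (V ⊗ₖ (1 : Matrix n n ℂ))ᴴ *ᵥ (fun p : n × n => C p.1 p.2)
      = fun p : n × n => (Vᴴ * C) p.1 p.2 := by
    ext ⟨i, s⟩
    simp [Matrix.mulVec, dotProduct, Fintype.sum_prod_type, Matrix.mul_apply, Matrix.one_apply,
      apply_ite (starRingEnd ℂ)]
  rw [Matrix.mul_vecMulVec, Matrix.vecMulVec_mul, h, ← h, Matrix.star_mulVec,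
    Matrix.conjTranspose_conjTranspose]

/-- A density matrix `ρ` with `⟨i| ρ V |i⟩ = 0` for all `i` yields, by purification, an input on
which the two measurements have orthogonal outputs. -/
theorem perfectlyDistinguishable_of_diag_eq_zero {V ρ : Matrix n n ℂ}
    (hV : V ∈ Matrix.unitaryGroup n ℂ) (hρ : ρ.PosSemidef) (htr : ρ.trace = 1)
    (h : ∀ i, (ρ * V) i i = 0) : PerfectlyDistinguishable (vonNeumann V) (vonNeumann 1) := by
  obtain ⟨B, rfl⟩ := CStarAlgebra.nonneg_iff_eq_star_mul_self.mp hρ.nonneg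
  rw [Matrix.star_eq_conjTranspose] at htr h
  have hVV : V * Vᴴ = 1 := Matrix.mem_unitaryGroup_iff.mp hV
  -- With ρ = BᴴB, the input is the pure state obtained by reading the entries of Bᴴ as a vector.
  refine perfectlyDistinguishable_of_traceNorm_eq_two hV
    (X := Matrix.vecMulVec (fun p : n × n => Bᴴ p.1 p.2) (star fun p : n × n => Bᴴ p.1 p.2)) ?_ ?_
  · rw [traceNorm_of_posSemidef (Matrix.posSemidef_vecMulVec_self_star _),
      trace_vecMulVec_uncurry, Matrix.conjTranspose_conjTranspose, htr, Complex.one_re]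
  · have hsub : ∀ X, tensorId (vonNeumann V - vonNeumann 1) n X
        = tensorId (vonNeumann V) n X - tensorId (vonNeumann 1) n X := by
      intro X
      ext p q
      simp [tensorId]
    rw [hsub, tensorId_vonNeumann, tensorId_vonNeumann, conjTranspose_mul_vecMulVec_mul,
      conjTranspose_mul_vecMulVec_mul, traceNorm_sub_of_mul_eq_zero
        (posSemidef_pinch_vecMulVec _) (posSemidef_pinch_vecMulVec _), trace_pinch, trace_pinch,
      trace_vecMulVec_uncurry, trace_vecMulVec_uncurry]
    · have h1 : (Vᴴ * Bᴴ * (Vᴴ * Bᴴ)ᴴ).trace = 1 := by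
        rw [Matrix.conjTranspose_mul, Matrix.conjTranspose_conjTranspose,
          Matrix.conjTranspose_conjTranspose, Matrix.trace_mul_comm]
        rw [show B * V * (Vᴴ * Bᴴ) = B * (V * Vᴴ) * Bᴴ by simp only [Matrix.mul_assoc], hVV,
          mul_one, Matrix.trace_mul_comm, htr]
      rw [h1, Matrix.conjTranspose_one, one_mul, Matrix.conjTranspose_conjTranspose, htr,
        Complex.one_re]
      norm_num
    · apply pinch_mul_pinch_eq_zero
      intro i
      rw [Matrix.conjTranspose_one, one_mul, Matrix.conjTranspose_mul,
        Matrix.conjTranspose_conjTranspose, Matrix.conjTranspose_conjTranspose, ← Matrix.mul_assoc]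
      exact h i

/-! ### Odd sums of unit vectors in a half plane -/

theorem cos_add_cos_pos {a b : ℝ} (hab : a * b ≤ 0) (h : |a - b| < Real.pi) :
    0 < Real.cos a + Real.cos b := by
  have h' : |a + b| < Real.pi := by
    refine lt_of_le_of_lt (sq_le_sq.mp ?_) h
    nlinarith
  rw [abs_lt] at h h'
  rw [Real.cos_add_cos]
  have h1 := Real.cos_pos_of_mem_Ioo (x := (a + b) / 2) ⟨by linarith, by linarith⟩
  have h2 := Real.cos_pos_of_mem_Ioo (x := (a - b) / 2) ⟨by linarith, by linarith⟩
  positivity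

/-- Pairing j with its reverse puts the two angles on opposite sides of the median and less than π
apart, so their cosines have positive sum. -/
theorem one_lt_sum_cos_sub_median {k : ℕ} (hk : 1 ≤ k) {θ : Fin (2 * k + 1) → ℝ} (hmono : Monotone θ)
    (hθ : ∀ i, |θ i| < Real.pi / 2) : 1 < ∑ j, Real.cos (θ j - θ ⟨k, by omega⟩) := by
  set m : Fin (2 * k + 1) := ⟨k, by omega⟩ with hm
  have hpos : ∀ j, 0 < Real.cos (θ j - θ m) + Real.cos (θ (Fin.rev j) - θ m) := by
    intro j
    apply cos_add_cos_pos
    · rcases le_total j m with h | h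
      · have h' : m ≤ Fin.rev j := by
          rw [Fin.le_def] at h ⊢
          simp only [hm, Fin.val_rev] at h ⊢
          omega
        exact mul_nonpos_of_nonpos_of_nonneg (sub_nonpos.mpr (hmono h))
          (sub_nonneg.mpr (hmono h'))
      · have h' : Fin.rev j ≤ m := by
          rw [Fin.le_def] at h ⊢
          simp only [hm, Fin.val_rev] at h ⊢
          omega
        exact mul_nonpos_of_nonneg_of_nonpos (sub_nonneg.mpr (hmono h))
          (sub_nonpos.mpr (hmono h'))
    · have h1 := abs_lt.mp (hθ j)
      have h2 := abs_lt.mp (hθ (Fin.rev j))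
      rw [abs_lt]
      constructor <;> linarith
  have hrev : Fin.rev m = m := by
    ext
    simp only [hm, Fin.val_rev]
    omega
  -- The median paired with itself contributes 2, and index 0, distinct from it as k ≥ 1, makes the
  -- bound strict. The paired sum counts every angle twice.
  have hlt := Finset.single_lt_sum
    (f := fun j => Real.cos (θ j - θ m) + Real.cos (θ (Fin.rev j) - θ m))
    (i := m) (j := 0) (by rw [Ne, Fin.ext_iff]; simp only [hm, Fin.val_zero]; omega)
    (Finset.mem_univ _) (Finset.mem_univ _) (hpos 0) fun j _ _ => (hpos j).le
  rw [hrev, sub_self, Real.cos_zero, Finset.sum_add_distrib,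
    show ∑ j, Real.cos (θ (Fin.rev j) - θ m) = ∑ j, Real.cos (θ j - θ m) from
      Equiv.sum_comp Fin.revPerm fun j => Real.cos (θ j - θ m)] at hlt
  linarith

/-- The sum of an odd number `≥ 3` of unit vectors in an open half plane has norm `> 1`. -/
theorem one_lt_norm_sum_of_odd {d : ℕ} (hd : 3 ≤ d) (hodd : Odd d) {μ : Fin d → ℂ}
    (hμ : ∀ i, ‖μ i‖ = 1) (hre : ∀ i, 0 < (μ i).re) : 1 < ‖∑ i, μ i‖ := by
  obtain ⟨k, rfl⟩ := hodd
  set σ := Tuple.sort fun i => Complex.arg (μ i)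
  have hlt := one_lt_sum_cos_sub_median (k := k) (by omega)
    (Tuple.monotone_sort fun i => Complex.arg (μ i))
    (fun i => Complex.abs_arg_lt_pi_div_two_iff.mpr (Or.inl (hre _)))
  set m : Fin (2 * k + 1) := ⟨k, by omega⟩
  have hcos : ∀ i, Real.cos (Complex.arg (μ i)) = (μ i).re := fun i => by
    rw [Complex.cos_arg (norm_ne_zero_iff.mp (by rw [hμ]; exact one_ne_zero)), hμ, div_one]
  have hsin : ∀ i, Real.sin (Complex.arg (μ i)) = (μ i).im := fun i => by
    rw [Complex.sin_arg, hμ, div_one]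
  have h1 : ∑ j, Real.cos (Complex.arg (μ (σ j)) - Complex.arg (μ (σ m)))
      = ((∑ i, μ i) * star (μ (σ m))).re := by
    rw [← Equiv.sum_comp σ μ, Finset.sum_mul, Complex.re_sum]
    refine Finset.sum_congr rfl fun j _ => ?_
    rw [Real.cos_sub, hcos, hcos, hsin, hsin]
    simp
  calc (1 : ℝ) < _ := hlt
    _ = ((∑ i, μ i) * star (μ (σ m))).re := h1
    _ ≤ ‖(∑ i, μ i) * star (μ (σ m))‖ := Complex.re_le_norm _
    _ = _ := by rw [norm_mul, norm_star, hμ, mul_one]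

/-! ### Existence of the density matrix by separation -/

theorem convex_setOf_density {n : Type*} [Fintype n] :
    Convex ℝ {ρ : Matrix n n ℂ | ρ.PosSemidef ∧ ρ.trace = 1} := by
  intro ρ hρ σ hσ a b ha hb hab
  refine ⟨(hρ.1.smul ha).add (hσ.1.smul hb), ?_⟩
  rw [Matrix.trace_add, Matrix.trace_smul, Matrix.trace_smul, hρ.2, hσ.2, ← add_smul, hab,
    one_smul]

/-- Density matrices are the BᴴB with B on the Hilbert–Schmidt unit sphere. -/
theorem isCompact_setOf_density :
    IsCompact {ρ : Matrix n n ℂ | ρ.PosSemidef ∧ ρ.trace = 1} := by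
  let g : EuclideanSpace ℂ (n × n) → Matrix n n ℂ := fun x => Matrix.of fun i j => x (i, j)
  have hg : Continuous g := continuous_matrix fun i j => by
    simp only [g, Matrix.of_apply]
    fun_prop
  have htr : ∀ x, ((g x)ᴴ * g x).trace = ((‖x‖ ^ 2 : ℝ) : ℂ) := by
    intro x
    rw [EuclideanSpace.norm_sq_eq, Fintype.sum_prod_type, Finset.sum_comm]
    simp [Matrix.trace, Matrix.mul_apply, g, Complex.conj_mul']
  have himage : {ρ : Matrix n n ℂ | ρ.PosSemidef ∧ ρ.trace = 1}
      = (fun x => (g x)ᴴ * g x) '' Metric.sphere 0 1 := by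
    ext ρ
    constructor
    · rintro ⟨hρ, hρ1⟩
      obtain ⟨B, rfl⟩ := CStarAlgebra.nonneg_iff_eq_star_mul_self.mp hρ.nonneg
      refine ⟨WithLp.toLp 2 fun p => B p.1 p.2, ?_, rfl⟩
      have h := (htr (WithLp.toLp 2 fun p => B p.1 p.2)).symm.trans hρ1
      rw [mem_sphere_zero_iff_norm, ← pow_eq_one_iff_of_nonneg (norm_nonneg _) two_ne_zero]
      exact_mod_cast h
    · rintro ⟨x, hx, rfl⟩
      refine ⟨Matrix.posSemidef_conjTranspose_mul_self _, ?_⟩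
      rw [htr, mem_sphere_zero_iff_norm.mp hx]
      norm_num
  rw [himage]
  exact (isCompact_sphere _ _).image (hg.matrix_conjTranspose.matrix_mul hg)

/-- Separation: either some density matrix `ρ` has `⟨i| ρ V |i⟩ = 0` for all `i`, or `V * D` has
positive definite real part for some diagonal `D`. -/
theorem exists_density_or_exists_diagonal (V : Matrix n n ℂ) :
    (∃ ρ : Matrix n n ℂ, ρ.PosSemidef ∧ ρ.trace = 1 ∧ ∀ i, (ρ * V) i i = 0) ∨
    ∃ D : n → ℂ, ∀ z : n → ℂ, z ≠ 0 → 0 < (star z ⬝ᵥ (V *ᵥ fun i => D i * z i)).re := by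
  let L : Matrix n n ℂ →ₗ[ℝ] (n → ℂ) :=
    { toFun := fun ρ i => (ρ * V) i i
      map_add' := fun ρ σ => by ext i; simp [add_mul]
      map_smul' := fun c ρ => by ext i; simp }
  have hLcont : Continuous L := LinearMap.continuous_of_finiteDimensional L
  by_cases h0 : (0 : n → ℂ) ∈ L '' {ρ : Matrix n n ℂ | ρ.PosSemidef ∧ ρ.trace = 1}
  · left
    obtain ⟨ρ, hρ, hL⟩ := h0
    exact ⟨ρ, hρ.1, hρ.2, fun i => congrFun hL i⟩
  · right
    obtain ⟨f, u, hf0, hf⟩ := RCLike.geometric_hahn_banach_point_closed (𝕜 := ℂ)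
      (convex_setOf_density.linear_image L) (isCompact_setOf_density.image hLcont).isClosed h0
    refine ⟨fun i => f (Pi.single i 1), fun z hz => ?_⟩
    have hfsum : ∀ w : n → ℂ, f w = ∑ i, w i * f (Pi.single i 1) := by
      intro w
      conv_lhs => rw [← Finset.univ_sum_single w]
      rw [map_sum]
      refine Finset.sum_congr rfl fun i _ => ?_
      rw [← smul_eq_mul, ← map_smul, ← Pi.single_smul, smul_eq_mul, mul_one]
    -- Normalising z turns its rank-one projection into a density matrix, on which the functional is
    -- positive.
    set c : ℝ := ‖(WithLp.toLp 2 z : EuclideanSpace ℂ n)‖ with hc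
    have hc0 : 0 < c := norm_pos_iff.mpr fun h => hz (by simpa using congrArg WithLp.ofLp h)
    set x : EuclideanSpace ℂ n := WithLp.toLp 2 ((c⁻¹ : ℂ) • z) with hx
    have hx1 : ‖x‖ = 1 := by
      rw [hx, WithLp.toLp_smul, norm_smul, ← hc, norm_inv, Complex.norm_of_nonneg hc0.le,
        inv_mul_cancel₀ hc0.ne']
    have hxtr : (Matrix.vecMulVec x.ofLp (star x.ofLp)).trace = 1 := by
      rw [← pow_eq_one_iff_of_nonneg (norm_nonneg _) two_ne_zero,
        EuclideanSpace.norm_sq_eq] at hx1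
      simp only [Matrix.trace, Matrix.diag_apply, Matrix.vecMulVec_apply, Pi.star_apply,
        Complex.star_def, Complex.mul_conj']
      exact_mod_cast hx1
    have hpos := hf (L (Matrix.vecMulVec x.ofLp (star x.ofLp)))
      ⟨_, ⟨Matrix.posSemidef_vecMulVec_self_star _, hxtr⟩, rfl⟩
    rw [map_zero, map_zero] at hf0
    have hpos' := hf0.trans hpos
    have hval : f (L (Matrix.vecMulVec x.ofLp (star x.ofLp)))
        = ((c⁻¹ * c⁻¹ : ℝ) : ℂ) * (star z ⬝ᵥ (V *ᵥ fun i => f (Pi.single i 1) * z i)) := by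
      rw [hfsum]
      simp only [L, LinearMap.coe_mk, AddHom.coe_mk, Matrix.mul_apply, Matrix.vecMulVec_apply,
        dotProduct, Matrix.mulVec, Finset.sum_mul, Finset.mul_sum]
      rw [Finset.sum_comm]
      refine Finset.sum_congr rfl fun k _ => Finset.sum_congr rfl fun i _ => ?_
      simp [hx]
      ring
    rw [hval] at hpos'
    change 0 < (((c⁻¹ * c⁻¹ : ℝ) : ℂ) * _).re at hpos'
    rw [Complex.re_ofReal_mul] at hpos'
    exact pos_of_mul_pos_right hpos' (by positivity)

theorem exists_density_diag_eq_zero {d : ℕ} (hd : 3 ≤ d) (hodd : Odd d)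
    {V : Matrix (Fin d) (Fin d) ℂ} (hV : V ∈ Matrix.unitaryGroup (Fin d) ℂ)
    (hdiag : ∀ i, 0 ≤ V i i) (htr : V.trace.re ≤ 1) :
    ∃ ρ : Matrix (Fin d) (Fin d) ℂ, ρ.PosSemidef ∧ ρ.trace = 1 ∧ ∀ i, (ρ * V) i i = 0 := by
  refine (exists_density_or_exists_diagonal V).resolve_right ?_
  rintro ⟨D, hD⟩
  have hD0 : ∀ i, D i ≠ 0 := by
    intro i hi
    have h1 := hD (Pi.single i 1) (by simp)
    have h2 : (fun j => D j * (Pi.single i 1 : Fin d → ℂ) j) = 0 := by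
      ext j
      by_cases hj : j = i
      · subst hj; simp [hi]
      · simp [hj]
    simp [h2] at h1
  set F : Fin d → ℂ := fun i => D i / ‖D i‖ with hF
  have hFn : ∀ i, ‖F i‖ = 1 := fun i => by
    rw [hF]
    simp [hD0 i]
  have hVF : V * Matrix.diagonal F ∈ Matrix.unitaryGroup (Fin d) ℂ := by
    refine mul_mem hV (Matrix.mem_unitaryGroup_iff.mpr ?_)
    rw [Matrix.star_eq_conjTranspose, Matrix.diagonal_conjTranspose, Matrix.diagonal_mul_diagonal,
      ← Matrix.diagonal_one]
    congr 1
    ext i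
    rw [Pi.star_apply, Complex.star_def, Complex.mul_conj', hFn]
    norm_num
  obtain ⟨Q, μ, hQ, hVQ, hμ⟩ := exists_unitary_diagonalization hVF
  have hQ1 : Qᴴ * Q = 1 := Matrix.mem_unitaryGroup_iff'.mp hQ
  have hre : ∀ j, 0 < (μ j).re := by
    intro j
    have heig : (V * Matrix.diagonal F) *ᵥ Q.col j = μ j • Q.col j := by
      have h1 : V * Matrix.diagonal F * Q = Q * Matrix.diagonal μ := by
        rw [hVQ, Matrix.mul_assoc, hQ1, mul_one]
      ext i
      have h2 := congrFun (congrFun h1 i) j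
      rw [Matrix.mul_diagonal] at h2
      rw [Pi.smul_apply, smul_eq_mul, mul_comm]
      exact h2
    have hne : Q.col j ≠ 0 := by
      intro h0
      have h1 := congrFun (congrFun hQ1 j) j
      have h2 : ∀ i, Q i j = 0 := fun i => congrFun h0 i
      simp [Matrix.mul_apply, h2] at h1
    -- Dividing by |D| makes Dz = Fq for the eigenvector q, so the form at z is a nonnegative
    -- multiple of μⱼ.
    set z : Fin d → ℂ := fun i => Q.col j i / ‖D i‖ with hz
    have hDn : ∀ i, (‖D i‖ : ℂ) ≠ 0 := fun i => by simpa using hD0 i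
    have hz0 : z ≠ 0 := by
      intro h0
      apply hne
      ext i
      have h1 := congrFun h0 i
      rw [hz] at h1
      exact (div_eq_zero_iff.mp h1).resolve_right (hDn i)
    have hpos := hD z hz0
    have h1 : (V *ᵥ fun i => D i * z i) = μ j • Q.col j := by
      rw [← heig, ← Matrix.mulVec_mulVec]
      congr 1
      ext i
      rw [Matrix.mulVec_diagonal, hz, hF]
      simp only
      ring
    have h2 : star z ⬝ᵥ (μ j • Q.col j) = ((∑ i, ‖Q.col j i‖ ^ 2 / ‖D i‖ : ℝ) : ℂ) * μ j := by
      rw [dotProduct_smul, smul_eq_mul, mul_comm, dotProduct, Complex.ofReal_sum]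
      congr 1
      refine Finset.sum_congr rfl fun i _ => ?_
      rw [Pi.star_apply, hz, Complex.ofReal_div, Complex.ofReal_pow, ← Complex.conj_mul']
      simp only [star_div₀, Complex.star_def, Complex.conj_ofReal]
      ring
    rw [h1, h2, Complex.re_ofReal_mul] at hpos
    exact pos_of_mul_pos_right hpos (Finset.sum_nonneg fun i _ => by positivity)
  have hlt := one_lt_norm_sum_of_odd hd hodd hμ hre
  have htr' : (V * Matrix.diagonal F).trace = ∑ i, μ i := by
    rw [hVQ, Matrix.trace_mul_comm, ← Matrix.mul_assoc, hQ1, one_mul, Matrix.trace_diagonal]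
  -- Nonnegativity of the diagonal of V enters here: Tr V is the largest modulus attainable by
  -- rephasing columns.
  have hle : ‖(V * Matrix.diagonal F).trace‖ ≤ V.trace.re := by
    rw [Matrix.trace, Matrix.trace, Complex.re_sum]
    refine norm_sum_le_of_le _ fun i _ => ?_
    rw [Matrix.diag_apply, Matrix.mul_diagonal, norm_mul, hFn, mul_one, Matrix.diag_apply]
    exact (congrArg Complex.re (Complex.norm_of_nonneg' (hdiag i))).le
  rw [htr'] at hle
  linarith

theorem vonNeumann_mul_of_isDiag (U : Matrix n n ℂ) {E : Matrix n n ℂ}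
    (hE : E ∈ Matrix.unitaryGroup n ℂ) (hEdiag : E.IsDiag) :
    vonNeumann (U * E) = vonNeumann U := by
  rw [← hEdiag.diagonal_diag] at hE ⊢
  generalize E.diag = e at hE
  have he : ∀ i, star (e i) * e i = 1 := by
    intro i
    have h := congrFun (congrFun (Matrix.mem_unitaryGroup_iff'.mp hE) i) i
    rwa [Matrix.star_eq_conjTranspose, Matrix.diagonal_conjTranspose,
      Matrix.diagonal_mul_diagonal, Matrix.diagonal_apply_eq, Matrix.one_apply_eq,
      Pi.star_apply] at h
  have hcol : ∀ i, (U * Matrix.diagonal e).col i = e i • U.col i := by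
    intro i
    ext j
    simp [Matrix.col, mul_comm]
  ext1 ρ
  change Matrix.diagonal _ = Matrix.diagonal _
  congr 1
  ext i
  rw [hcol, star_smul, Matrix.mulVec_smul, smul_dotProduct, dotProduct_smul, smul_smul, he,
    one_smul]

end Sufficient

end MeasurementDiscrimination

theorem mainTheorem5 (d : ℕ) (U E : Matrix (Fin d) (Fin d) ℂ)
    (hU : U ∈ Matrix.unitaryGroup (Fin d) ℂ)
    (hE : E ∈ Matrix.unitaryGroup (Fin d) ℂ) (hEdiag : E.IsDiag)
    (hUE : ∀ i, 0 ≤ (U * E) i i) :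
    (MeasurementDiscrimination.PerfectlyDistinguishable
        (MeasurementDiscrimination.vonNeumann U) (MeasurementDiscrimination.vonNeumann 1) →
      (U * E).trace.re ≤ (d : ℝ) - 2) ∧
    (3 ≤ d → Odd d → (U * E).trace.re ≤ 1 →
      MeasurementDiscrimination.PerfectlyDistinguishable
        (MeasurementDiscrimination.vonNeumann U) (MeasurementDiscrimination.vonNeumann 1)) ∧
    (d = 3 →
      (MeasurementDiscrimination.PerfectlyDistinguishable
          (MeasurementDiscrimination.vonNeumann U) (MeasurementDiscrimination.vonNeumann 1) ↔
        (U * E).trace.re ≤ 1)) := by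
  have hV : U * E ∈ Matrix.unitaryGroup (Fin d) ℂ := mul_mem hU hE
  rw [← MeasurementDiscrimination.vonNeumann_mul_of_isDiag U hE hEdiag]
  have necessary : MeasurementDiscrimination.PerfectlyDistinguishable
        (MeasurementDiscrimination.vonNeumann (U * E)) (MeasurementDiscrimination.vonNeumann 1) →
      (U * E).trace.re ≤ (d : ℝ) - 2 := fun h => by
    simpa using h.re_trace_le hV
  have sufficient : 3 ≤ d → Odd d → (U * E).trace.re ≤ 1 →
      MeasurementDiscrimination.PerfectlyDistinguishable
        (MeasurementDiscrimination.vonNeumann (U * E)) (MeasurementDiscrimination.vonNeumann 1) :=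
    fun hd hodd htr => by
      obtain ⟨ρ, hρ, hρtr, hρV⟩ :=
        MeasurementDiscrimination.exists_density_diag_eq_zero hd hodd hV hUE htr
      exact MeasurementDiscrimination.perfectlyDistinguishable_of_diag_eq_zero hV hρ hρtr hρV
  refine ⟨necessary, sufficient, ?_⟩
  rintro rfl
  refine ⟨fun h => (necessary h).trans (by norm_num), sufficient le_rfl ⟨1, rfl⟩⟩
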